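/- Let $k$ be a commutative Artinian ring and let $A$ be an Artin $k$-algebra, i.e. a $k$-algebra which is finitely generated as a $k$-module. Let $\operatorname{ind}A$ be the class of finitely generated indecomposable left $A$-modules. For $X,Y\in\operatorname{ind}A$, call $Y$ a predecessor of $X$ if there is a finite chain of nonzero morphisms $Y=M_0\to M_1\to\cdots\to M_t=X$ with all $M_i\in\operatorname{ind}A$. For a class $\mathcal C$ of $A$-modules let $\mathcal L_{\mathcal C}$ be the class of those $X\in\operatorname{ind}A$ all of whose predecessors lie in $\mathcal C$. For an integer $m\ge 1$ let $\mathcal L_A^m$ be the class of those $X\in\operatorname{ind}A$ all of whose predecessors have projective dimension at most $m$. For a class $\mathcal L$ of modules, $\operatorname{add}\mathcal L$ is the class of direct summands of finite direct sums of modules in $\mathcal L$. For positive integers $m,n$, $A$ is called $(m,n)$-almost hereditary if $\operatorname{gl.dim}A=m+n$ and every $X\in\operatorname{ind}A$ satisfies $\operatorname{pd}X\le m$ or $\operatorname{id}X\le n$. (Here "or" is inclusive.) (a) Let $\mathcal C$ be a torsion-free class (that is, the torsion-free part of a torsion pair) in the category of finitely generated left $A$-modules. If $A\in\operatorname{add}\mathcal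 L_{\mathcal C}$, then every $X\in\operatorname{ind}A$ satisfies $X\in\mathcal C$ or $\operatorname{id}X\le 1$. (b) Let $m\ge 1$ be an integer and assume that $A\in\operatorname{add}\mathcal L_A^m$. Then: (1) $\operatorname{gl.dim}A\le m+1$, and every $X\in\operatorname{ind}A$ satisfies $\operatorname{pd}X\le m$ or $\operatorname{id}X\le 1$; (2) if moreover $\operatorname{gl.dim}A=m+1$, then $A$ is $(m,1)$-almost hereditary. -/

import Mathlib

open CategoryTheory

universe u v

namespace ArtinAlg

section

variable (A : Type u) [Ring A]

/-- The class `ind A`: finitely generated indecomposable left `A`-modules (all of them, rather than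
one representative of each isomorphism class). -/
def ind : ObjectProperty (ModuleCat.{u} A) := fun X => Module.Finite A X ∧ Indecomposable X

/-- A one-step path: a nonzero morphism between objects of `ind A`. -/
def Step (X Y : ModuleCat.{u} A) : Prop :=
  ind A X ∧ ind A Y ∧ ∃ f : X ⟶ Y, f ≠ 0

/-- `IsPredecessor A Y X`: there is a path `Y = M₀ ⟶ M₁ ⟶ ⋯ ⟶ Mₜ = X` of nonzero morphisms between
objects of `ind A`. -/
def IsPredecessor (Y X : ModuleCat.{u} A) : Prop :=
  ind A Y ∧ ind A X ∧ Relation.ReflTransGen (Step A) Y X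

/-- `𝓛_C`: the objects of `ind A` all of whose predecessors in `ind A` lie in `C`. -/
def leftPartOf (C : ObjectProperty (ModuleCat.{u} A)) : ObjectProperty (ModuleCat.{u} A) :=
  fun X => ind A X ∧ ∀ Y : ModuleCat.{u} A, IsPredecessor A Y X → C Y

/-- `𝓛_A^m`: the objects of `ind A` all of whose predecessors in `ind A` have projective dimension
at most `m`. -/
def leftPart (m : ℕ) : ObjectProperty (ModuleCat.{u} A) :=
  leftPartOf A (fun Y => projectiveDimension Y ≤ (m : WithBot ℕ∞))

/-- `add L`: the direct summands of finite direct sums of modules in `L`. -/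
def add (L : ObjectProperty (ModuleCat.{u} A)) : ObjectProperty (ModuleCat.{u} A) :=
  fun M => ∃ (n : ℕ) (X : Fin n → ModuleCat.{u} A), (∀ j, L (X j)) ∧
    Nonempty (Retract M (ModuleCat.of A (∀ j, X j)))

/-- The (left) global dimension: the supremum of the projective dimensions of all left modules. -/
noncomputable def globalDimension : WithBot ℕ∞ :=
  ⨆ M : ModuleCat.{u} A, projectiveDimension M

/-- `(T, C)` is a torsion pair in the category of finitely generated left `A`-modules. -/
structure IsTorsionPair (T C : ObjectProperty (ModuleCat.{u} A)) : Prop where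
  mem_torsion_iff (X : ModuleCat.{u} A) :
    T X ↔ Module.Finite A X ∧ ∀ Y : ModuleCat.{u} A, C Y → ∀ f : X ⟶ Y, f = 0
  mem_torsionFree_iff (Y : ModuleCat.{u} A) :
    C Y ↔ Module.Finite A Y ∧ ∀ X : ModuleCat.{u} A, T X → ∀ f : X ⟶ Y, f = 0

/-- A torsion-free class of finitely generated left `A`-modules. -/
def IsTorsionFreeClass (C : ObjectProperty (ModuleCat.{u} A)) : Prop :=
  ∃ T : ObjectProperty (ModuleCat.{u} A), IsTorsionPair A T C

/-- `(m, n)`-almost hereditary algebras. -/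
structure IsAlmostHereditary (m n : ℕ) : Prop where
  left_pos : 0 < m
  right_pos : 0 < n
  globalDimension_eq : globalDimension A = ((m + n : ℕ) : WithBot ℕ∞)
  dimension_le (X : ModuleCat.{u} A) : ind A X →
    projectiveDimension X ≤ (m : WithBot ℕ∞) ∨ injectiveDimension X ≤ (n : WithBot ℕ∞)

end

end ArtinAlg

/-!
The argument rests on two facts. The algebra `A` is left Noetherian, so finitely generated modules can
be handled by induction over indecomposable summands (`ArtinAlg.induction_on_indecomposable`). And if
`A ∈ add 𝓛_C`, then every indecomposable module with a nonzero map to `A` lies in `𝓛_C`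
(`ArtinAlg.leftPartOf_of_ne_zero`).

To see that `X ∈ C` or `id X ≤ 1`, embed an indecomposable `X` into an injective module `I` with
cokernel `K`. Then `id X ≤ 1` as soon as `K` is injective, and by Baer's criterion this means that
maps `J ⟶ K` from left ideals `J` extend to `A`; it suffices to lift them to `I`, and one may replace `J` by an
indecomposable summand `Z`. Pulling back gives an extension `0 ⟶ X ⟶ E ⟶ Z ⟶ 0` with `E` finitely
generated. If no indecomposable summand of `E` receives a nonzero map from `X` and has a nonzero map
to `Z`, then the summands killed by the second map together contain the image of `X`, and they are
contained in it by exactness; so the extension splits and the lift exists. Otherwise `X` is a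
predecessor of `Z` (`ArtinAlg.isPredecessor_or_exists_endomorphism`); since `Z` maps nontrivially to
`A`, it lies in `𝓛_C`, whence `X ∈ C`.

For `𝓛_A^m` this is applied to the class of modules of projective dimension at most `m`. The
indecomposable summands of left ideals lie in `𝓛_A^m`, so cyclic modules have projective dimension
at most `m + 1`, and Auslander's theorem (`ArtinAlg.hasProjectiveDimensionLE_of_forall_quotient`)
bounds the global dimension by `m + 1`.
-/

open CategoryTheory.Limits

namespace ArtinAlg

variable {A : Type u} [Ring A]

/-- To prove a property of all finitely generated modules over a Noetherian ring it suffices to prove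
it for zero modules, for indecomposable modules, and for direct sums of two modules that have it. -/
theorem induction_on_indecomposable [IsNoetherianRing A] {P : ModuleCat.{u} A → Prop}
    (zero : ∀ M : ModuleCat.{u} A, IsZero M → P M)
    (sum : ∀ M Y Z : ModuleCat.{u} A, (M ≅ Y ⊞ Z) → P Y → P Z → P M)
    (indecomposable : ∀ M : ModuleCat.{u} A, ind A M → P M)
    (M : ModuleCat.{u} A) [Module.Finite A M] : P M := by
  -- Noetherian induction on the kernel of a surjection from `M`; quantifying over all such surjections
  -- makes a separate hypothesis of invariance under isomorphism unnecessary.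
  suffices H : ∀ (N : Submodule A M) (Q : ModuleCat.{u} A) (q : M ⟶ Q),
      Function.Surjective q.hom → LinearMap.ker q.hom = N → P Q from
    H _ M (𝟙 M) Function.surjective_id rfl
  intro N
  induction N using IsNoetherian.induction with
  | hgt N ih =>
    intro Q q hq hN
    by_cases hQ : IsZero Q
    · exact zero Q hQ
    by_cases hi : Indecomposable Q
    · exact indecomposable Q ⟨Module.Finite.of_surjective q.hom hq, hi⟩
    obtain ⟨Y, Z, φ, hY, hZ⟩ : ∃ Y Z : ModuleCat.{u} A, ∃ _ : Q ≅ Y ⊞ Z,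
        ¬ IsZero Y ∧ ¬ IsZero Z := by
      by_contra! h
      exact hi ⟨hQ, fun Y Z φ => or_iff_not_imp_left.2 fun hY => h Y Z φ hY⟩
    -- The quotient of `Q` by a nonzero summand is a quotient of `M` by a larger kernel.
    have key : ∀ (W W' : ModuleCat.{u} A) (p : Q ⟶ W) (i : W' ⟶ Q) [Epi p] [Mono i],
        i ≫ p = 0 → ¬ IsZero W' → P W := by
      intro W W' p i _ _ hip hW'
      refine ih (LinearMap.ker (q ≫ p).hom) ?_ W (q ≫ p) ?_ rfl
      · refine lt_of_le_of_ne ?_ fun h => hW' ?_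
        · rw [← hN]
          exact LinearMap.ker_le_ker_comp q.hom p.hom
        · rw [ModuleCat.isZero_iff_subsingleton]
          refine subsingleton_of_forall_eq 0 fun w => ?_
          obtain ⟨x, hx⟩ := hq (i.hom w)
          have hxk : x ∈ LinearMap.ker (q ≫ p).hom := by
            have := congr($hip w)
            simpa [hx] using this
          rw [← h, ← hN, LinearMap.mem_ker, hx] at hxk
          exact (ModuleCat.mono_iff_injective i).1 inferInstance (by simpa using hxk)
      · exact ((ModuleCat.epi_iff_surjective p).1 inferInstance).comp hq
    exact sum Q Y Z φ
      (key Y Z (φ.hom ≫ biprod.fst) (biprod.inr ≫ φ.inv) (by simp) hZ)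
      (key Z Y (φ.hom ≫ biprod.snd) (biprod.inl ≫ φ.inv) (by simp) hY)

/-- Either `X ⟶ E ⟶ Z` gives rise to a path from `X` to `Z` through an indecomposable summand of `E`,
or `E` has an endomorphism that fixes the image of `X` and is killed by `E ⟶ Z`: the projection onto
the indecomposable summands of `E` that receive a nonzero map from `X`, on which `g` then vanishes. -/
lemma isPredecessor_or_exists_endomorphism [IsNoetherianRing A] {X Z : ModuleCat.{u} A}
    (hX : ind A X) (hZ : ind A Z) (E : ModuleCat.{u} A) [Module.Finite A E]
    (f : X ⟶ E) (g : E ⟶ Z) :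
    IsPredecessor A X Z ∨ ∃ e : E ⟶ E, f ≫ e = f ∧ e ≫ g = 0 := by
  by_cases h : IsPredecessor A X Z
  · exact Or.inl h
  refine Or.inr (induction_on_indecomposable
    (P := fun E => ∀ (f : X ⟶ E) (g : E ⟶ Z), ∃ e : E ⟶ E, f ≫ e = f ∧ e ≫ g = 0)
    ?_ ?_ ?_ E f g)
  · intro E hE f g
    exact ⟨0, hE.eq_of_tgt _ _, by simp⟩
  · intro E E₁ E₂ φ h₁ h₂ f g
    obtain ⟨e₁, hf₁, hg₁⟩ := h₁ (f ≫ φ.hom ≫ biprod.fst) (biprod.inl ≫ φ.inv ≫ g)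
    obtain ⟨e₂, hf₂, hg₂⟩ := h₂ (f ≫ φ.hom ≫ biprod.snd) (biprod.inr ≫ φ.inv ≫ g)
    refine ⟨φ.hom ≫ biprod.map e₁ e₂ ≫ φ.inv, ?_, ?_⟩
    · rw [← cancel_mono φ.hom]
      apply biprod.hom_ext <;> simpa
    · rw [← cancel_epi φ.inv]
      apply biprod.hom_ext' <;> simpa
  · intro W hW f g
    by_cases hf : f = 0
    · exact ⟨0, by simp [hf], by simp⟩
    by_cases hg : g = 0
    · exact ⟨𝟙 W, by simp, by simp [hg]⟩
    exact absurd ⟨hX, hZ, .tail (.single ⟨hX, hW, f, hf⟩) ⟨hW, hZ, g, hg⟩⟩ h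

/-- A nonzero map from `Z` to `A` has a nonzero component in some module of `𝓛_C`, of which `Z` is
then a predecessor. -/
lemma leftPartOf_of_ne_zero {C : ObjectProperty (ModuleCat.{u} A)}
    (hA : add A (leftPartOf A C) (ModuleCat.of A A)) {Z : ModuleCat.{u} A} (hZ : ind A Z)
    (h : Z ⟶ ModuleCat.of A A) (h0 : h ≠ 0) : leftPartOf A C Z := by
  obtain ⟨n, X, hX, ⟨r⟩⟩ := hA
  obtain ⟨j, hj⟩ : ∃ j, (h ≫ r.i) ≫ ModuleCat.ofHom (LinearMap.proj j) ≠ 0 := by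
    by_contra! H
    have : h ≫ r.i = 0 := by
      ext z j
      exact congr($(H j) z)
    exact h0 (by rw [← Category.comp_id h, ← r.retract, reassoc_of% this, zero_comp])
  refine ⟨hZ, fun Y hY => (hX j).2 Y ⟨hY.1, (hX j).1, hY.2.2.tail ⟨hZ, (hX j).1, _, hj⟩⟩⟩

/-- If `X` is not a predecessor of `Z`, then maps from `Z` lift along every epimorphism `I ⟶ K` with
kernel `X`: the extension of `Z` by `X` obtained by pulling back splits. -/
lemma exists_lift_of_not_isPredecessor [IsNoetherianRing A] {X I Z : ModuleCat.{u} A}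
    (hX : ind A X) (hZ : ind A Z) (hXZ : ¬ IsPredecessor A X Z)
    {K : ModuleCat.{u} A} {i : X ⟶ I} {p : I ⟶ K} (w : i ≫ p = 0)
    (hS : (ShortComplex.mk i p w).ShortExact) (g : Z ⟶ K) : ∃ l : Z ⟶ I, l ≫ p = g := by
  have := hX.1
  have := hZ.1
  have w' : i ≫ p = (0 : X ⟶ Z) ≫ g := by rw [w, zero_comp]
  let S : ShortComplex (ModuleCat.{u} A) := ShortComplex.mk
    (pullback.lift i 0 w') (pullback.snd p g) (pullback.lift_snd i 0 w')
  have : Epi p := hS.epi_g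
  have : Mono i := hS.mono_f
  have : Mono S.f := mono_of_mono_fac (pullback.lift_fst i 0 w')
  have hE : S.ShortExact :=
    { exact := by
        refine ShortComplex.exact_of_f_is_kernel _ (KernelFork.IsLimit.ofι' _ _ fun {T} k hk => ?_)
        have hk' : (k ≫ pullback.fst p g) ≫ p = 0 := by
          have hk : k ≫ pullback.snd p g = 0 := hk
          rw [Category.assoc, pullback.condition, reassoc_of% hk, zero_comp]
        refine ⟨hS.exact.lift _ hk', ?_⟩
        apply pullback.hom_ext
        · rw [Category.assoc, pullback.lift_fst]
          exact hS.exact.lift_f _ hk'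
        · rw [Category.assoc, pullback.lift_snd, comp_zero]
          exact hk.symm
      epi_g := inferInstanceAs (Epi (pullback.snd p g)) }
  have : IsNoetherian A S.X₂ := isNoetherian_of_range_eq_ker S.f.hom S.g.hom
    hE.exact.moduleCat_range_eq_ker
  obtain ⟨e, hfe, heg⟩ :=
    (isPredecessor_or_exists_endomorphism hX hZ S.X₂ S.f S.g).resolve_left hXZ
  have := hE.epi_g
  -- `1 - e` kills `X` and lies over the identity of `Z`, so it induces a section of `S.g`; composing
  -- that section with the projection to `I` gives the lift.
  have hd : S.f ≫ (𝟙 _ - e) ≫ pullback.fst p g = 0 := by simp [reassoc_of% hfe]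
  refine ⟨hE.exact.desc _ hd, ?_⟩
  rw [← cancel_epi S.g, hE.exact.g_desc_assoc]
  have : e ≫ pullback.snd p g = 0 := heg
  simp [S, pullback.condition, reassoc_of% this]

/-- The cokernel of an embedding of `X ∉ C` into an injective module satisfies Baer's criterion, because
`X` is not a predecessor of any indecomposable summand of a left ideal. -/
theorem mem_or_injectiveDimension_le_one [IsNoetherianRing A]
    {C : ObjectProperty (ModuleCat.{u} A)}
    (hA : add A (leftPartOf A C) (ModuleCat.of A A)) {X : ModuleCat.{u} A} (hX : ind A X) :
    C X ∨ injectiveDimension X ≤ (1 : WithBot ℕ∞) := by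
  refine or_iff_not_imp_left.2 fun hCX => ?_
  obtain ⟨pr⟩ := EnoughInjectives.presentation X
  have hS : (ShortComplex.mk _ _ (cokernel.condition pr.f)).ShortExact :=
    { exact := ShortComplex.exact_cokernel pr.f }
  have lift : ∀ (J : ModuleCat.{u} A) [Module.Finite A J] (h : J ⟶ ModuleCat.of A A) [Mono h]
      (g : J ⟶ cokernel pr.f), ∃ l : J ⟶ pr.J, l ≫ cokernel.π pr.f = g := by
    intro J _
    refine induction_on_indecomposable (P := fun J => ∀ (h : J ⟶ ModuleCat.of A A) [Mono h]
      (g : J ⟶ cokernel pr.f), ∃ l : J ⟶ pr.J, l ≫ cokernel.π pr.f = g) ?_ ?_ ?_ J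
    · intro M hM h _ g
      exact ⟨0, hM.eq_of_src _ _⟩
    · intro M Y Z φ hY hZ h _ g
      obtain ⟨l₁, hl₁⟩ := hY (biprod.inl ≫ φ.inv ≫ h) (biprod.inl ≫ φ.inv ≫ g)
      obtain ⟨l₂, hl₂⟩ := hZ (biprod.inr ≫ φ.inv ≫ h) (biprod.inr ≫ φ.inv ≫ g)
      refine ⟨φ.hom ≫ biprod.desc l₁ l₂, ?_⟩
      rw [← cancel_epi φ.inv]
      apply biprod.hom_ext' <;> simpa
    · intro Z hZ h _ g
      have h0 : h ≠ 0 := fun h0 => hZ.2.1 (IsZero.of_mono_eq_zero h h0)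
      exact exists_lift_of_not_isPredecessor hX hZ
        (fun H => hCX ((leftPartOf_of_ne_zero hA hZ h h0).2 X H)) _ hS g
  have hK : Injective (cokernel pr.f) := by
    rw [← Module.injective_iff_injective_object]
    refine Module.Baer.injective fun J g => ?_
    have : Mono (ModuleCat.ofHom J.subtype) :=
      (ModuleCat.mono_iff_injective _).2 J.injective_subtype
    obtain ⟨l, hl⟩ := lift (ModuleCat.of A J) (ModuleCat.ofHom J.subtype) (ModuleCat.ofHom g)
    refine ⟨(Injective.factorThru l (ModuleCat.ofHom J.subtype) ≫ cokernel.π pr.f).hom,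
      fun x hx => ?_⟩
    have := Injective.comp_factorThru l (ModuleCat.ofHom J.subtype) =≫ cokernel.π pr.f
    rw [hl, Category.assoc] at this
    exact congr($this (⟨x, hx⟩ : J))
  have : HasInjectiveDimensionLE X 1 :=
    (hS.hasInjectiveDimensionLT_X₃_iff 0 pr.injective).1 inferInstance
  exact_mod_cast (injectiveDimension_le_iff X 1).2 this

/-- Baer's criterion in higher degrees: injective dimension can be tested on cyclic modules. -/
lemma hasInjectiveDimensionLE_of_subsingleton_ext_quotient [HasExt.{u} (ModuleCat.{u} A)] (n : ℕ)
    (M : ModuleCat.{u} A)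
    (h : ∀ J : Ideal A, Subsingleton (Abelian.Ext (ModuleCat.of A (A ⧸ J)) M (n + 1))) :
    HasInjectiveDimensionLE M n := by
  induction n generalizing M with
  | zero =>
    suffices Injective M from inferInstanceAs (HasInjectiveDimensionLT M 1)
    rw [← Module.injective_iff_injective_object]
    refine Module.Baer.injective fun J g => ?_
    have hS := ModuleCat.shortComplex_shortExact
      (ModuleCat.shortComplexOfCompEqZero J.subtype J.mkQ
        (LinearMap.exact_subtype_mkQ J).linearMap_comp_eq_zero)
      (LinearMap.exact_subtype_mkQ J) J.injective_subtype J.mkQ_surjective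
    have := h J
    obtain ⟨φ, hφ⟩ := Abelian.Ext.contravariant_sequence_exact₁ hS M
      (Abelian.Ext.mk₀ (ModuleCat.ofHom g)) (n₁ := 1) rfl (this.elim _ _)
    obtain ⟨φ, rfl⟩ := Abelian.Ext.homEquiv₀.symm.surjective φ
    refine ⟨φ.hom, fun x hx => ?_⟩
    have := Abelian.Ext.homEquiv₀.symm.injective
      (a₁ := ModuleCat.ofHom J.subtype ≫ φ) (a₂ := ModuleCat.ofHom g) (by simpa using hφ)
    exact congr($this (⟨x, hx⟩ : J))
  | succ n ih =>
    obtain ⟨pr⟩ := EnoughInjectives.presentation M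
    have hS : (ShortComplex.mk _ _ (cokernel.condition pr.f)).ShortExact :=
      { exact := ShortComplex.exact_cokernel pr.f }
    have := ih (cokernel pr.f) fun J => subsingleton_of_forall_eq 0 fun x => by
      obtain ⟨y, rfl⟩ := Abelian.Ext.covariant_sequence_exact₃ _ hS x rfl ((h J).elim _ _)
      rw [Abelian.Ext.eq_zero_of_injective y, Abelian.Ext.zero_comp]
    exact (hS.hasInjectiveDimensionLT_X₃_iff n pr.injective).1 this

/-- **Auslander's theorem**: a bound for the projective dimensions of the cyclic modules bounds the
projective dimensions of all modules. The vanishing of `Ext` from cyclic modules bounds all injective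
dimensions, hence makes `Ext` vanish on all pairs of modules. -/
theorem hasProjectiveDimensionLE_of_forall_quotient (n : ℕ)
    (h : ∀ J : Ideal A, HasProjectiveDimensionLE (ModuleCat.of A (A ⧸ J)) n)
    (M : ModuleCat.{u} A) : HasProjectiveDimensionLE M n := by
  have : HasExt.{u} (ModuleCat.{u} A) := hasExt_of_enoughInjectives _
  refine hasProjectiveDimensionLT_of_enoughInjectives M (n + 1) fun N => ?_
  have := hasInjectiveDimensionLE_of_subsingleton_ext_quotient n N fun J =>
    HasProjectiveDimensionLT.subsingleton _ (n + 1) (n + 1) le_rfl N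
  exact HasInjectiveDimensionLT.subsingleton N (n + 1) (n + 1) le_rfl M

/-- Left ideals have projective dimension at most `m`, since their indecomposable summands embed into
`A` and therefore lie in `𝓛_A^m`. -/
lemma hasProjectiveDimensionLE_of_mono [IsNoetherianRing A] {m : ℕ}
    (hA : add A (leftPart A m) (ModuleCat.of A A)) (J : ModuleCat.{u} A) [Module.Finite A J]
    (h : J ⟶ ModuleCat.of A A) [Mono h] : HasProjectiveDimensionLE J m := by
  refine induction_on_indecomposable (P := fun J => ∀ (h : J ⟶ ModuleCat.of A A) [Mono h],
    HasProjectiveDimensionLE J m) ?_ ?_ ?_ J h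
  · intro M hM _ _
    have := hM.hasProjectiveDimensionLT_zero
    exact hasProjectiveDimensionLT_of_ge M 0 _ (Nat.zero_le _)
  · intro M Y Z φ hY hZ h _
    have := hY (biprod.inl ≫ φ.inv ≫ h)
    have := hZ (biprod.inr ≫ φ.inv ≫ h)
    exact hasProjectiveDimensionLT_of_iso φ.symm _
  · intro Z hZ h _
    have h0 : h ≠ 0 := fun h0 => hZ.2.1 (IsZero.of_mono_eq_zero h h0)
    exact (projectiveDimension_le_iff Z m).1
      ((leftPartOf_of_ne_zero hA hZ h h0).2 Z ⟨hZ, hZ, .refl⟩)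

theorem globalDimension_le_add_one [IsNoetherianRing A] {m : ℕ}
    (hA : add A (leftPart A m) (ModuleCat.of A A)) :
    globalDimension A ≤ ((m + 1 : ℕ) : WithBot ℕ∞) := by
  refine iSup_le fun M => (projectiveDimension_le_iff M (m + 1)).2 ?_
  refine hasProjectiveDimensionLE_of_forall_quotient (m + 1) (fun J => ?_) M
  have hS := ModuleCat.shortComplex_shortExact
    (ModuleCat.shortComplexOfCompEqZero J.subtype J.mkQ
      (LinearMap.exact_subtype_mkQ J).linearMap_comp_eq_zero)
    (LinearMap.exact_subtype_mkQ J) J.injective_subtype J.mkQ_surjective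
  have : Mono (ModuleCat.ofHom J.subtype) :=
    (ModuleCat.mono_iff_injective _).2 J.injective_subtype
  exact (hS.hasProjectiveDimensionLT_X₃_iff m
    (ModuleCat.projective_of_free (Module.Basis.singleton PUnit.{1} A))).2
    (hasProjectiveDimensionLE_of_mono hA (ModuleCat.of A J) (ModuleCat.ofHom J.subtype))

end ArtinAlg

theorem mainTheorem7 {k : Type v} [CommRing k] [IsArtinianRing k]
    {A : Type u} [Ring A] [Algebra k A] [Module.Finite k A] :
    (∀ C : ObjectProperty (ModuleCat.{u} A), ArtinAlg.IsTorsionFreeClass A C →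
      ArtinAlg.add A (ArtinAlg.leftPartOf A C) (ModuleCat.of A A) →
      ∀ X : ModuleCat.{u} A, ArtinAlg.ind A X →
        C X ∨ injectiveDimension X ≤ (1 : WithBot ℕ∞)) ∧
    (∀ m : ℕ, 0 < m →
      ArtinAlg.add A (ArtinAlg.leftPart A m) (ModuleCat.of A A) →
      (ArtinAlg.globalDimension A ≤ ((m + 1 : ℕ) : WithBot ℕ∞) ∧
        ∀ X : ModuleCat.{u} A, ArtinAlg.ind A X →
          projectiveDimension X ≤ (m : WithBot ℕ∞) ∨
            injectiveDimension X ≤ (1 : WithBot ℕ∞)) ∧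
      (ArtinAlg.globalDimension A = ((m + 1 : ℕ) : WithBot ℕ∞) →
        ArtinAlg.IsAlmostHereditary A m 1)) := by
  have : IsNoetherianRing A := IsNoetherianRing.of_finite k A
  refine ⟨fun C _ hA X hX => ArtinAlg.mem_or_injectiveDimension_le_one hA hX,
    fun m hm hA => ?_⟩
  have hdim : ∀ X : ModuleCat.{u} A, ArtinAlg.ind A X →
      projectiveDimension X ≤ (m : WithBot ℕ∞) ∨ injectiveDimension X ≤ (1 : WithBot ℕ∞) :=
    fun X hX => ArtinAlg.mem_or_injectiveDimension_le_one hA hX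
  refine ⟨⟨ArtinAlg.globalDimension_le_add_one hA, hdim⟩, fun hgl => ?_⟩
  exact ⟨hm, one_pos, hgl, fun X hX => by exact_mod_cast hdim X hX⟩
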